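/- Let $q=6+2\sqrt5$, let $\sigma=\frac{1}{\sqrt q}\begin{pmatrix}1&q-1\\1&-1\end{pmatrix}$ and $\tau=\begin{pmatrix}1&0\\0&-1\end{pmatrix}$, and let $G\subset GL_2(\mathbb{C})$ be the group generated by $\sigma$ and $\tau$. A matrix $\begin{pmatrix}a&b\\c&e\end{pmatrix}$ acts on $f\in\mathbb{C}[x,y]$ by $f(x,y)\mapsto f(ax+by,\,cx+ey)$, and $R_{6+2\sqrt5}=\mathbb{C}[x,y]^{G}$ denotes the ring of polynomials invariant under all elements of $G$. Suppose that $W\in R_{6+2\sqrt5}$ has the form $$W(x,y)=x^n+\sum_{i=d}^{n}A_i\,x^{n-i}y^i\qquad(A_i\in\mathbb{C},\ A_d\neq 0,\ d\le n)$$ and that its degree $n$ is even. Then $$d\le 2\left[\frac{n}{10}\right]+2,$$ where $[t]$ denotes the greatest integer not exceeding the real number $t$. -/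

import Mathlib

namespace MallowsSloane

open MvPolynomial

/-- The polynomial ring `ℂ[x, y]`; the variable `x` is `X 0` and `y` is `X 1`. -/
abbrev Poly : Type := MvPolynomial (Fin 2) ℂ

/-- The action of a matrix `σ = (a b; c d)` on polynomials by linear substitution,
`f ^ σ (x, y) = f (a x + b y, c x + d y)`. -/
noncomputable def act (M : Matrix (Fin 2) (Fin 2) ℂ) : Poly →ₐ[ℂ] Poly :=
  aeval ![C (M 0 0) * X 0 + C (M 0 1) * X 1, C (M 1 0) * X 0 + C (M 1 1) * X 1]

/-- The matrix of the MacWilliams transform, `σ_q = (1 / √q) (1 (q - 1); 1 (-1))`. -/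
noncomputable def macWilliamsMatrix (q : ℝ) : Matrix (Fin 2) (Fin 2) ℂ :=
  (1 / ((Real.sqrt q : ℝ) : ℂ)) • !![1, (q : ℂ) - 1; 1, -1]

theorem macWilliamsMatrix_mul_self {q : ℝ} (hq : 0 < q) :
    macWilliamsMatrix q * macWilliamsMatrix q = 1 := by
  have h0 : ((Real.sqrt q : ℝ) : ℂ) ≠ 0 := by
    exact_mod_cast (Real.sqrt_pos.2 hq).ne'
  have h1 : ((Real.sqrt q : ℝ) : ℂ) ^ 2 = (q : ℂ) := by
    exact_mod_cast Real.sq_sqrt hq.le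
  have h2 : (q : ℂ) ≠ 0 := by exact_mod_cast hq.ne'
  have h3 : (1 / ((Real.sqrt q : ℝ) : ℂ)) * (1 / ((Real.sqrt q : ℝ) : ℂ)) * (q : ℂ) = 1 := by
    rw [← h1]
    field_simp
  unfold macWilliamsMatrix
  rw [Matrix.smul_mul, Matrix.mul_smul, smul_smul]
  ext i j
  fin_cases i <;> fin_cases j <;> simp at h3 ⊢ <;> exact h3

/-- The MacWilliams transform `σ_q` for `q > 0`, as an element of `GL₂(ℂ)`. -/
noncomputable def sigma (q : ℝ) (hq : 0 < q) : GL (Fin 2) ℂ :=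
  ⟨macWilliamsMatrix q, macWilliamsMatrix q,
    macWilliamsMatrix_mul_self hq, macWilliamsMatrix_mul_self hq⟩

/-- The matrix `τ = (1 0; 0 (-1))`, as an element of `GL₂(ℂ)`. -/
noncomputable def tau : GL (Fin 2) ℂ :=
  ⟨!![1, 0; 0, -1], !![1, 0; 0, -1], by simp [Matrix.one_fin_two], by simp [Matrix.one_fin_two]⟩

/-- The number `q = 6 + 2√5`. -/
noncomputable def q₀ : ℝ := 6 + 2 * Real.sqrt 5

theorem q₀_pos : 0 < q₀ := by
  unfold q₀
  positivity

/-- The group generated by `σ_q` and `τ` in `GL₂(ℂ)`, for `q = 6 + 2√5`. -/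
noncomputable def transformGroup : Subgroup (GL (Fin 2) ℂ) :=
  Subgroup.closure {sigma q₀ q₀_pos, tau}

/-- The ring `ℂ[x, y] ^ G`, where `G` is that group: it consists of the polynomials that are invariant under every element of that group. -/
noncomputable def invariantRing : Subalgebra ℂ Poly where
  carrier := {f | ∀ g ∈ transformGroup, act (g : Matrix (Fin 2) (Fin 2) ℂ) f = f}
  mul_mem' := fun ha hb g hg => by rw [map_mul, ha g hg, hb g hg]
  add_mem' := fun ha hb g hg => by rw [map_add, ha g hg, hb g hg]
  algebraMap_mem' := fun r g _ => AlgHom.commutes _ r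

end MallowsSloane

/-!
Put `t² = q - 1`, `z = x + i t y` and `w = x - i t y`. The product of the two generators acts as the
rotation `z ↦ ζ z`, `w ↦ ζ⁻¹ w` with `ζ` a primitive fifth root of unity, because
`√q = 1 + √5` (`MallowsSloane.diag_rotation`, `MallowsSloane.modEq_five_of_coeff_ne_zero`).
As the degree `n = 2 N` is even, `W` is a combination of the monomials `(z w) ^ N (z / w) ^ (5 j)` with
`|j| ≤ [n / 10]`; the rotation alone gives this, and no generators of the invariant ring are needed.

Restrict to `x = 1`, `t y = X`, and put `E = (z / w) ^ 5`, `g = z w = 1 + X²`, `k = [n / 10] + 1`.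
Then `F = W / g ^ N` is a combination of `E ^ j` with `|j| < k`, so that `F' E ^ k / (E - 1) ^ (2 k)`
is a combination of `E ^ r E' / (E - 1) ^ (2 k)` with `r + 1 < 2 k`, which have no residue at `X = 0`
(`coeff_pow_mul_derivative_mul_inv_pow`). On the other hand, if `d > 2 k`, then
`F = g ^ (-N) + O(X ^ (2 k + 1))`, and since `E / (E - 1) ^ 2 = -g ^ 5 / (4 X² p²)` with
`p = 5 - 10 X² + X⁴`, the residue is a nonzero multiple of the coefficient of `X ^ (2 k - 2)` in
`g ^ (5 k - N - 1) / p ^ (2 k)`. The exponent of `g` is nonnegative because `10 k > n`, and `1 / p` has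
positive even coefficients, so this coefficient is positive
(`coeff_pow_mul_inv_quartic_pow_pos`): a contradiction. This is the Bürmann-Lagrange formula in a
form that needs only power series.
-/

/-! ### Residues of exact derivatives -/

open PowerSeries in
/-- With `D = X δ`, the coefficient is the residue of `D' / D ^ (p + 1)`, which is the derivative of
`-1 / (p D ^ p)`. Writing the powers of `D` as `X ^ i δ ^ i` keeps everything in `R⟦X⟧`. -/
theorem coeff_inv_pow_mul_derivative {R : Type*} [Field R] [CharZero R] {δ χ : R⟦X⟧}
    (h : δ * χ = 1) (p : ℕ) (hp : p ≠ 0) :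
    coeff p (χ ^ (p + 1) * d⁄dX R (X * δ)) = 0 := by
  obtain ⟨p, rfl⟩ := Nat.exists_eq_succ_of_ne_zero hp
  have h1 : d⁄dX R χ = - χ ^ 2 * d⁄dX R δ := by
    have h2 := congrArg (d⁄dX R) h
    simp only [Derivation.leibniz, smul_eq_mul, Derivation.map_one_eq_zero] at h2
    linear_combination χ * h2 - d⁄dX R χ * h
  have h2 : ((p : R⟦X⟧) + 1) * (χ ^ (p + 2) * d⁄dX R (X * δ))
      = ((p : R⟦X⟧) + 1) * χ ^ (p + 1) - X * d⁄dX R (χ ^ (p + 1)) := by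
    rw [Derivation.leibniz_pow, h1]
    simp only [Derivation.leibniz, smul_eq_mul, nsmul_eq_mul, derivative_X]
    push_cast
    linear_combination ((p : R⟦X⟧) + 1) * χ ^ (p + 1) * h
  have h3 := congrArg (coeff (p + 1)) h2
  have hc : ((p : R⟦X⟧) + 1) = C ((p : R) + 1) := by simp
  rw [hc, coeff_C_mul, map_sub, coeff_C_mul, coeff_succ_X_mul, coeff_derivative,
    mul_comm (coeff _ _) (_ : R), sub_self] at h3
  exact (mul_eq_zero.1 h3).resolve_left (by exact_mod_cast Nat.succ_ne_zero p)

open PowerSeries in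
/-- The residue of `E ^ r E' / (E - 1) ^ l` vanishes for `r + 1 < l`: expand `E ^ r` in powers of
`E - 1`. -/
theorem coeff_pow_mul_derivative_mul_inv_pow {R : Type*} [Field R] [CharZero R] {E δ χ : R⟦X⟧}
    (hE : E = 1 + X * δ) (h : δ * χ = 1) {r l : ℕ} (hr : r + 1 < l) :
    coeff (l - 1) (E ^ r * d⁄dX R E * χ ^ l) = 0 := by
  have hd : d⁄dX R E = d⁄dX R (X * δ) := by rw [hE]; simp
  rw [hd, hE, add_comm 1, add_pow, Finset.sum_mul, Finset.sum_mul, map_sum]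
  refine Finset.sum_eq_zero fun i hi => ?_
  have hi : i ≤ r := by simpa [Nat.lt_succ_iff] using hi
  obtain ⟨a, rfl⟩ : ∃ a, l = i + (a + 1) := ⟨l - i - 1, by omega⟩
  -- cancelling `δ ^ i` against `χ ^ i` leaves the residue of `D' / D ^ (a + 1)`, with `a ≥ 1`
  have e : (X * δ) ^ i * 1 ^ (r - i) * (r.choose i : R⟦X⟧) * d⁄dX R (X * δ) * χ ^ (i + (a + 1))
      = C (r.choose i : R) * (X ^ i * (χ ^ (a + 1) * d⁄dX R (X * δ))) := by
    have : δ ^ i * χ ^ i = 1 := by rw [← mul_pow, h, one_pow]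
    rw [map_natCast, pow_add χ, mul_pow, one_pow]
    linear_combination (X ^ i * (r.choose i : R⟦X⟧) * d⁄dX R (X * δ) * χ ^ (a + 1)) * this
  rw [e, coeff_C_mul, show i + (a + 1) - 1 = a + i by omega, coeff_X_pow_mul,
    coeff_inv_pow_mul_derivative h a (by omega), mul_zero]

/-! ### Positivity of the coefficients -/

open PowerSeries in
theorem coeff_mul_nonneg_of_nonneg {f g : ℝ⟦X⟧} (hf : ∀ n, 0 ≤ coeff n f) (hg : ∀ n, 0 ≤ coeff n g)
    (n : ℕ) : 0 ≤ coeff n (f * g) := by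
  rw [coeff_mul]
  exact Finset.sum_nonneg fun i _ => mul_nonneg (hf _) (hg _)

open PowerSeries in
theorem coeff_pow_nonneg_of_nonneg {f : ℝ⟦X⟧} (hf : ∀ n, 0 ≤ coeff n f) (k n : ℕ) :
    0 ≤ coeff n (f ^ k) := by
  induction k generalizing n with
  | zero => rw [pow_zero, coeff_one]; split_ifs <;> norm_num
  | succ k ih => rw [pow_succ]; exact coeff_mul_nonneg_of_nonneg ih hf n

open PowerSeries in
/-- The odd coefficients of `1 / (5 - 10 X² + X⁴)` vanish; the even ones satisfy
`5 c (j + 2) = 10 c (j + 1) - c j`, so they are positive and nondecreasing. -/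
theorem coeff_inv_quartic_nondecreasing {P : ℝ⟦X⟧} (hP : (5 - 10 * X ^ 2 + X ^ 4) * P = 1) (j : ℕ) :
    0 < coeff (2 * j) P ∧ coeff (2 * j) P ≤ coeff (2 * (j + 1)) P ∧
      coeff (2 * j + 1) P = 0 ∧ coeff (2 * (j + 1) + 1) P = 0 := by
  have h : C 5 * P = 1 + C 10 * (X ^ 2 * P) - X ^ 4 * P := by
    have h5 : (C 5 : ℝ⟦X⟧) = 5 := rfl
    have h10 : (C 10 : ℝ⟦X⟧) = 10 := rfl
    rw [h5, h10]; linear_combination hP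
  have hc := fun n => congrArg (coeff n) h
  simp only [map_sub, map_add, coeff_C_mul, coeff_X_pow_mul', coeff_one] at hc
  induction j with
  | zero =>
    have h0 := hc 0; have h1 := hc 1; have h2 := hc 2; have h3 := hc 3
    norm_num at h0 h1 h2 h3 ⊢
    refine ⟨?_, ?_, ?_, ?_⟩ <;> linarith
  | succ j ih =>
    obtain ⟨a, b, c, d⟩ := ih
    have h0 := hc (2 * j + 4); have h1 := hc (2 * j + 5)
    simp at h0 h1
    simp only [mul_add, add_assoc] at *
    norm_num at *
    refine ⟨?_, ?_, ?_, ?_⟩ <;> linarith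

open PowerSeries in
theorem coeff_pow_mul_inv_quartic_pow_pos {P : ℝ⟦X⟧}
    (hP : (5 - 10 * X ^ 2 + X ^ 4) * P = 1) (a b j : ℕ) :
    0 < coeff (2 * j) ((1 + X ^ 2) ^ a * P ^ (b + 1)) := by
  have hP0 : ∀ n, 0 ≤ coeff n P := fun n => by
    obtain ⟨i, rfl | rfl⟩ := Nat.even_or_odd' n
    · exact (coeff_inv_quartic_nondecreasing hP i).1.le
    · exact (coeff_inv_quartic_nondecreasing hP i).2.2.1.ge
  have hg : ∀ n, 0 ≤ coeff n (1 + X ^ 2 : ℝ⟦X⟧) := fun n => by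
    rw [map_add, coeff_one, coeff_X_pow]; split_ifs <;> norm_num
  have hQ : ∀ n, 0 ≤ coeff n ((1 + X ^ 2 : ℝ⟦X⟧) ^ a * P ^ b) :=
    coeff_mul_nonneg_of_nonneg (coeff_pow_nonneg_of_nonneg hg a) (coeff_pow_nonneg_of_nonneg hP0 b)
  rw [pow_succ P, ← mul_assoc, coeff_mul]
  refine lt_of_lt_of_le ?_ (Finset.single_le_sum (f := fun x : ℕ × ℕ =>
      coeff x.1 ((1 + X ^ 2 : ℝ⟦X⟧) ^ a * P ^ b) * coeff x.2 P)
    (fun i _ => mul_nonneg (hQ _) (hP0 _)) (a := (0, 2 * j)) (by simp))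
  refine mul_pos ?_ (coeff_inv_quartic_nondecreasing hP j).1
  have h0 : 0 < coeff 0 P := (coeff_inv_quartic_nondecreasing hP 0).1
  rw [coeff_zero_eq_constantCoeff_apply] at h0 ⊢
  simpa using pow_pos h0 b

/-! ### The residue of a short sum of powers of `z / w` -/

open PowerSeries in
/-- Let `z = 1 + iX`, `w = 1 - iX`, `g = z w = 1 + X²`, `p = 5 - 10 X² + X⁴` and `E = (z / w) ^ 5`. Then
`E - 1 = 2 i X p / w ^ 5`, so `g ^ 5 / (X p) ^ 2 = -4 E / (E - 1) ^ 2`. The hypotheses on the exponents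
say that `z ^ a w ^ b / g ^ N = E ^ (r - k)`, and the coefficient is, up to a factor, the residue of
`(E ^ (r - k))' E ^ k / (E - 1) ^ (2 k) = (r - k) E ^ (r - 1) E' / (E - 1) ^ (2 k)`. -/
theorem coeff_derivative_monomial_eq_zero {w' g' p' : ℂ⟦X⟧} (hw : (1 - C Complex.I * X) * w' = 1)
    (hg : (1 + X ^ 2) * g' = 1) (hp : (5 - 10 * X ^ 2 + X ^ 4) * p' = 1)
    {k N r a b : ℕ} (hr : 1 ≤ r) (hrk : r < 2 * k) (ha : a + 5 * k = N + 5 * r)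
    (hab : a + b = 2 * N) :
    coeff (2 * k - 1) (d⁄dX ℂ ((1 + C Complex.I * X) ^ a * (1 - C Complex.I * X) ^ b * g' ^ N) *
      ((1 + X ^ 2) ^ 5 * p' ^ 2) ^ k) = 0 := by
  have hI : (C Complex.I : ℂ⟦X⟧) ^ 2 = -1 := by rw [← map_pow, Complex.I_sq]; simp
  generalize hz0 : 1 + C Complex.I * X = z
  generalize hw0 : 1 - C Complex.I * X = w at *
  have hzw : z * w = 1 + X ^ 2 := by
    rw [← hz0, ← hw0]; linear_combination (-X ^ 2) * hI
  rw [← hzw] at hg ⊢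
  set E := z ^ 5 * w' ^ 5 with hE
  set δ := 2 * C Complex.I * (5 - 10 * X ^ 2 + X ^ 4) * w' ^ 5 with hδ
  set χ := w ^ 5 * p' * C (1 / (2 * Complex.I)) with hχ
  have hw5 : w ^ 5 * w' ^ 5 = 1 := by rw [← mul_pow, hw, one_pow]
  have h2I : 2 * C Complex.I * C (1 / (2 * Complex.I)) = (1 : ℂ⟦X⟧) := by
    rw [show (2 : ℂ⟦X⟧) = C 2 from rfl, ← map_mul, ← map_mul,
      show 2 * Complex.I * (1 / (2 * Complex.I)) = 1 by field_simp, map_one]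
  have hEδ : E = 1 + X * δ := by
    have : z ^ 5 = w ^ 5 + 2 * C Complex.I * X * (5 - 10 * X ^ 2 + X ^ 4) := by
      rw [← hz0, ← hw0]
      linear_combination (20 * C Complex.I * X ^ 3 +
        2 * C Complex.I * X ^ 5 * (C Complex.I ^ 2 - 1)) * hI
    rw [hE, hδ]; linear_combination w' ^ 5 * this + hw5
  have hδχ : δ * χ = 1 := by
    rw [hδ, hχ]
    linear_combination (w ^ 5 * w' ^ 5 * (5 - 10 * X ^ 2 + X ^ 4) * p') * h2I +
      (w ^ 5 * w' ^ 5) * hp + hw5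
  have hκ : (z * w) ^ 5 * p' ^ 2 = C (-4) * (E * χ ^ 2) := by
    have h4 : (C (-4) : ℂ⟦X⟧) = -4 := by rw [map_neg]; rfl
    rw [h4, hE, hχ]
    have : (4 : ℂ⟦X⟧) * C (1 / (2 * Complex.I)) ^ 2 = -1 := by
      linear_combination (2 * C Complex.I * C (1 / (2 * Complex.I)) + 1) * -h2I +
        4 * C (1 / (2 * Complex.I)) ^ 2 * hI
    linear_combination (z ^ 5 * w ^ 5 * p' ^ 2 * w ^ 5 * w' ^ 5) * this -
      z ^ 5 * w ^ 5 * p' ^ 2 * hw5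
  set F := z ^ a * w ^ b * g' ^ N with hF
  have hFE : F * E ^ k = E ^ r := by
    have hgN : z ^ N * w ^ N * g' ^ N = 1 := by rw [← mul_pow, ← mul_pow, hg, one_pow]
    have h1 : w ^ (5 * k) * w' ^ (5 * k) = 1 := by rw [← mul_pow, hw, one_pow]
    have h2 : w ^ (5 * r) * w' ^ (5 * r) = 1 := by rw [← mul_pow, hw, one_pow]
    have e1 : z ^ a * z ^ (5 * k) = z ^ N * z ^ (5 * r) := by rw [← pow_add, ← pow_add, ha]
    have e2 : w ^ b * w ^ (5 * r) = w ^ N * w ^ (5 * k) := by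
      rw [← pow_add, ← pow_add]; congr 1; omega
    rw [hF, hE, mul_pow, mul_pow, ← pow_mul, ← pow_mul, ← pow_mul, ← pow_mul]
    linear_combination (w ^ b * g' ^ N * w' ^ (5 * k)) * e1 -
      (z ^ N * z ^ (5 * r) * w ^ b * g' ^ N * w' ^ (5 * k)) * h2 +
      (z ^ N * z ^ (5 * r) * g' ^ N * w' ^ (5 * k) * w' ^ (5 * r)) * e2 +
      (z ^ (5 * r) * w' ^ (5 * r) * w ^ (5 * k) * w' ^ (5 * k)) * hgN +
      (z ^ (5 * r) * w' ^ (5 * r)) * h1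
  obtain ⟨r, rfl⟩ : ∃ s, r = s + 1 := ⟨r - 1, by omega⟩
  obtain ⟨k, rfl⟩ : ∃ s, k = s + 1 := ⟨k - 1, by omega⟩
  have hE0 : E ≠ 0 := by
    intro h
    have := congrArg constantCoeff hEδ
    simp [h] at this
  -- differentiate `F * E ^ (k + 1) = E ^ (r + 1)`; this avoids negative powers of `E`
  have hd : d⁄dX ℂ F * E ^ (k + 1) = C ((r : ℂ) - k) * (E ^ r * d⁄dX ℂ E) := by
    have h1 := congrArg (d⁄dX ℂ) hFE
    simp only [Derivation.leibniz, Derivation.leibniz_pow, smul_eq_mul, nsmul_eq_mul,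
      add_tsub_cancel_right] at h1
    push_cast at h1
    rw [map_sub, map_natCast, map_natCast]
    refine mul_right_cancel₀ hE0 ?_
    linear_combination E * h1 - ((k : ℂ⟦X⟧) + 1) * d⁄dX ℂ E * hFE
  have key : d⁄dX ℂ F * ((z * w) ^ 5 * p' ^ 2) ^ (k + 1) =
      C ((-4) ^ (k + 1) * ((r : ℂ) - k)) * (E ^ r * d⁄dX ℂ E * χ ^ (2 * (k + 1))) := by
    rw [hκ, mul_pow, mul_pow, (C : ℂ →+* ℂ⟦X⟧).map_mul, (C : ℂ →+* ℂ⟦X⟧).map_pow, ← pow_mul]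
    linear_combination (C (-4) ^ (k + 1) * χ ^ (2 * (k + 1))) * hd
  rw [key, coeff_C_mul, coeff_pow_mul_derivative_mul_inv_pow hEδ hδχ (by omega), mul_zero]

open PowerSeries in
/-- For `g' = 1 / (1 + X²)`, a perturbation of `g' ^ N` divisible by `X ^ d` changes the derivative only
from degree `d - 1` on. -/
theorem exists_derivative_mul_pow_eq {g' : ℂ⟦X⟧} (hg : (1 + X ^ 2) * g' = 1) (Q : ℂ⟦X⟧)
    (N : ℕ) {l d : ℕ} (hd : l < d) :
    ∃ R, d⁄dX ℂ ((1 + X ^ d * Q) * g' ^ N) =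
      C (-2 * (N : ℂ)) * (X * g' ^ (N + 1)) + X ^ l * R := by
  obtain ⟨e, rfl⟩ : ∃ e, d = l + e + 1 := ⟨d - l - 1, by omega⟩
  have hg1 : d⁄dX ℂ g' = -2 * X * g' ^ 2 := by
    have h2 := congrArg (d⁄dX ℂ) hg
    simp only [Derivation.leibniz, Derivation.leibniz_pow, smul_eq_mul, nsmul_eq_mul, map_add,
      Derivation.map_one_eq_zero, derivative_X] at h2
    norm_num at h2
    linear_combination g' * h2 - d⁄dX ℂ g' * hg
  have hC : (C (-2 * (N : ℂ)) : ℂ⟦X⟧) = -2 * (N : ℂ⟦X⟧) := by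
    rw [map_mul, map_natCast, map_neg]; rfl
  have hgN : d⁄dX ℂ (g' ^ N) = -2 * (N : ℂ⟦X⟧) * (X * g' ^ (N + 1)) := by
    rw [Derivation.leibniz_pow, hg1]
    cases N with
    | zero => simp
    | succ N =>
      simp only [smul_eq_mul, nsmul_eq_mul, add_tsub_cancel_right]
      ring
  refine ⟨X ^ e * (((l + e : ℕ) + 1 : ℂ⟦X⟧) * (Q * g' ^ N) + X * d⁄dX ℂ (Q * g' ^ N)), ?_⟩
  rw [add_mul, one_mul, mul_assoc (X ^ _) Q, map_add, Derivation.leibniz (d⁄dX ℂ) (X ^ _),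
    hgN, Derivation.leibniz_pow, hC]
  simp only [smul_eq_mul, nsmul_eq_mul, derivative_X, add_tsub_cancel_right, mul_one]
  push_cast
  ring

open PowerSeries in
theorem coeff_derivative_sum_eq_zero {ι : Type*} (s : Finset ι) (B : ι → ℂ) (a b : ι → ℕ) {k N : ℕ}
    {w' g' p' : ℂ⟦X⟧} (hw : (1 - C Complex.I * X) * w' = 1)
    (hg : (1 + X ^ 2) * g' = 1) (hp : (5 - 10 * X ^ 2 + X ^ 4) * p' = 1)
    (hs : ∀ m ∈ s, a m + b m = 2 * N ∧ ∃ r, 1 ≤ r ∧ r < 2 * k ∧ a m + 5 * k = N + 5 * r) :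
    coeff (2 * k - 1) (d⁄dX ℂ ((∑ m ∈ s, C (B m) *
      ((1 + C Complex.I * X) ^ a m * (1 - C Complex.I * X) ^ b m)) * g' ^ N) *
      ((1 + X ^ 2) ^ 5 * p' ^ 2) ^ k) = 0 := by
  rw [Finset.sum_mul, map_sum, Finset.sum_mul, map_sum]
  refine Finset.sum_eq_zero fun m hm => ?_
  obtain ⟨hab, r, hr, hrk, ha⟩ := hs m hm
  rw [mul_assoc (C _), ← PowerSeries.smul_eq_C_mul, Derivation.map_smul, smul_mul_assoc,
    coeff_smul, coeff_derivative_monomial_eq_zero hw hg hp hr hrk ha hab, smul_zero]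

open PowerSeries in
theorem exists_mul_eq_one {K : Type*} [Field K] {f : K⟦X⟧} (hf : constantCoeff f ≠ 0) :
    ∃ g, f * g = 1 :=
  ⟨f⁻¹, PowerSeries.mul_inv_cancel f hf⟩

open PowerSeries in
/-- A combination of monomials `z ^ a w ^ b` with `z / w` occurring, after division by `(z w) ^ N`, only
to the powers `5 (r - k)`, `0 < r < 2 k`, is not `1 + O(X ^ (2 k + 1))`: the two sides have different
residues. -/
theorem sum_ne_one_add_X_pow_mul {ι : Type*} (s : Finset ι) (B : ι → ℂ) (a b : ι → ℕ) {k N d : ℕ}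
    (Q : ℂ⟦X⟧) (hN : N ≠ 0) (hNk : N < 5 * k) (hd : 2 * k < d)
    (hs : ∀ m ∈ s, a m + b m = 2 * N ∧ ∃ r, 1 ≤ r ∧ r < 2 * k ∧ a m + 5 * k = N + 5 * r) :
    ∑ m ∈ s, C (B m) * ((1 + C Complex.I * X) ^ a m * (1 - C Complex.I * X) ^ b m) ≠
      1 + X ^ d * Q := by
  intro H
  obtain ⟨w', hw⟩ : ∃ w' : ℂ⟦X⟧, (1 - C Complex.I * X) * w' = 1 :=
    exists_mul_eq_one (by simp)
  obtain ⟨g', hg⟩ : ∃ g' : ℂ⟦X⟧, (1 + X ^ 2) * g' = 1 :=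
    exists_mul_eq_one (by simp)
  -- the inverse of the quartic is taken over `ℝ`, where its coefficients can be compared with `0`
  obtain ⟨P, hP⟩ : ∃ P : ℝ⟦X⟧, (5 - 10 * X ^ 2 + X ^ 4) * P = 1 :=
    exists_mul_eq_one (by
      simp only [map_add, map_sub, map_mul, map_pow, constantCoeff_X, map_ofNat]; norm_num)
  obtain ⟨p', hp'⟩ : ∃ p' : ℂ⟦X⟧, p' = PowerSeries.map (algebraMap ℝ ℂ) P := ⟨_, rfl⟩
  have hp : (5 - 10 * X ^ 2 + X ^ 4) * p' = 1 := by
    have := congrArg (PowerSeries.map (algebraMap ℝ ℂ)) hP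
    simpa only [map_mul, map_add, map_sub, map_pow, map_one, map_X, map_ofNat, ← hp'] using this
  have h0 := coeff_derivative_sum_eq_zero s B a b hw hg hp hs
  obtain ⟨j, rfl⟩ : ∃ j, k = j + 1 := ⟨k - 1, by omega⟩
  obtain ⟨c, hc⟩ : ∃ c, 5 * (j + 1) = c + (N + 1) := ⟨5 * (j + 1) - (N + 1), by omega⟩
  obtain ⟨R, hR⟩ := exists_derivative_mul_pow_eq hg Q N hd
  have hgN : (1 + X ^ 2) ^ (N + 1) * g' ^ (N + 1) = 1 := by rw [← mul_pow, hg, one_pow]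
  have hκ : g' ^ (N + 1) * ((1 + X ^ 2) ^ 5 * p' ^ 2) ^ (j + 1) =
      (1 + X ^ 2) ^ c * p' ^ (2 * j + 1 + 1) := by
    rw [mul_pow, ← pow_mul, ← pow_mul, hc, pow_add, show 2 * (j + 1) = 2 * j + 1 + 1 by ring]
    linear_combination (1 + X ^ 2) ^ c * p' ^ (2 * j + 1 + 1) * hgN
  have hsplit : d⁄dX ℂ ((1 + X ^ d * Q) * g' ^ N) * ((1 + X ^ 2) ^ 5 * p' ^ 2) ^ (j + 1) =
      C (-2 * (N : ℂ)) * (X * ((1 + X ^ 2) ^ c * p' ^ (2 * j + 1 + 1))) +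
        X ^ (2 * (j + 1)) * (R * ((1 + X ^ 2) ^ 5 * p' ^ 2) ^ (j + 1)) := by
    rw [hR, ← hκ]; ring
  rw [H, hsplit, map_add, coeff_X_pow_mul', if_neg (by omega), add_zero, coeff_C_mul,
    show 2 * (j + 1) - 1 = 2 * j + 1 by omega, coeff_succ_X_mul] at h0
  have hpos := coeff_pow_mul_inv_quartic_pow_pos hP c (2 * j + 1) j
  have hmap : (1 + X ^ 2) ^ c * p' ^ (2 * j + 1 + 1) =
      PowerSeries.map (algebraMap ℝ ℂ) ((1 + X ^ 2) ^ c * P ^ (2 * j + 1 + 1)) := by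
    simp only [map_mul, map_add, map_pow, map_one, map_X, hp']
  rw [hmap, coeff_map] at h0
  have : ((coeff (2 * j) ((1 + X ^ 2) ^ c * P ^ (2 * j + 1 + 1)) : ℝ) : ℂ) ≠ 0 :=
    Complex.ofReal_ne_zero.2 hpos.ne'
  exact mul_ne_zero (mul_ne_zero (by norm_num) (Nat.cast_ne_zero.2 hN)) this h0

/-! ### Diagonalizing the rotation -/

open MvPolynomial in
theorem coeff_aeval_scale (a b : ℂ) (p : MvPolynomial (Fin 2) ℂ) (m : Fin 2 →₀ ℕ) :
    coeff m (aeval ![C a * X 0, C b * X 1] p : MvPolynomial (Fin 2) ℂ) =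
      a ^ m 0 * b ^ m 1 * coeff m p := by
  induction p using MvPolynomial.induction_on' with
  | monomial u c =>
    have : (aeval ![C a * X 0, C b * X 1] (monomial u c) : MvPolynomial (Fin 2) ℂ) =
        monomial u (a ^ u 0 * b ^ u 1 * c) := by
      rw [aeval_monomial, Finsupp.prod_fintype _ _ (by simp), Fin.prod_univ_two, monomial_eq,
        Finsupp.prod_fintype _ _ (by simp), Fin.prod_univ_two]
      simp [algebraMap_eq, mul_pow]
      ring
    rw [this, coeff_monomial, coeff_monomial]
    split_ifs with h
    · rw [h]
    · simp
  | add p q hp hq => rw [map_add, coeff_add, hp, hq, coeff_add, mul_add]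

namespace MallowsSloane
open MvPolynomial

/-- The change of variables `x = (z + w) / 2`, `y = (z - w) / (2 i t)`, that is `z = x + i t y` and
`w = x - i t y`; the new variables `z`, `w` are again called `X 0` and `X 1`. For `t² = q - 1` it
diagonalizes the rotation generated by the MacWilliams transform and `τ`. -/
noncomputable def diag (t : ℂ) : Poly →ₐ[ℂ] Poly :=
  aeval ![C (1 / 2) * (X 0 + X 1), C (1 / (2 * Complex.I * t)) * (X 0 - X 1)]

/-- The product of the two generators is diagonal in the coordinates `z`, `w`. -/
theorem diag_rotation {s t : ℂ} (hs : s ≠ 0) (ht : t ≠ 0) (f : Poly) :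
    aeval ![C ((1 + Complex.I * t) / s) * X 0, C ((1 - Complex.I * t) / s) * X 1] (diag t f) =
      diag t (act !![1, 0; 0, -1] (act ((1 / s) • !![1, t ^ 2; 1, -1]) f)) := by
  have hI := Complex.I_sq
  suffices h : (aeval ![C ((1 + Complex.I * t) / s) * X 0,
      C ((1 - Complex.I * t) / s) * X 1]).comp (diag t) =
      (diag t).comp ((act !![1, 0; 0, -1]).comp (act ((1 / s) • !![1, t ^ 2; 1, -1]))) from
    DFunLike.congr_fun h f
  refine MvPolynomial.algHom_ext fun i => ?_
  fin_cases i
  · simp [act, diag]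
    refine MvPolynomial.funext fun x => ?_
    simp
    field_simp
    ring
  · simp [act, diag]
    refine MvPolynomial.funext fun x => ?_
    simp
    field_simp
    linear_combination (-t * (x 0 + x 1)) * hI

theorem invariant_rotation {W : Poly} (hW : W ∈ invariantRing) {s t : ℂ}
    (hs : s = ((Real.sqrt q₀ : ℝ) : ℂ)) (ht : t ^ 2 = (q₀ : ℂ) - 1) :
    act !![1, 0; 0, -1] (act ((1 / s) • !![1, t ^ 2; 1, -1]) W) = W := by
  have h1 : act (macWilliamsMatrix q₀) W = W :=
    hW (sigma q₀ q₀_pos) (Subgroup.subset_closure (by simp))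
  have h2 : act !![1, 0; 0, -1] W = W := hW tau (Subgroup.subset_closure (by simp))
  rw [hs, ht]
  rw [macWilliamsMatrix] at h1
  rw [h1, h2]

theorem sqrt_q₀ : Real.sqrt q₀ = 1 + Real.sqrt 5 := by
  rw [q₀, Real.sqrt_eq_iff_mul_self_eq (by positivity) (by positivity)]
  nlinarith [Real.sq_sqrt (show (0 : ℝ) ≤ 5 by norm_num)]

/-- Since `√q = 1 + √5` solves `s² = 2 s + 4`, the eigenvalue `ζ = (1 + i t) / √q` of the rotation is a
primitive fifth root of unity: `ζ + ζ⁻¹ = 2 / √q` is a root of `c² + c - 1`. -/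
theorem modEq_five_of_coeff_ne_zero {s t : ℂ} (hs : s ^ 2 = 2 * s + 4) (hs0 : s ≠ 0)
    (ht : t ^ 2 = s ^ 2 - 1) {V : Poly}
    (hV : aeval ![C ((1 + Complex.I * t) / s) * X 0, C ((1 - Complex.I * t) / s) * X 1] V = V)
    {m : Fin 2 →₀ ℕ} (hm : coeff m V ≠ 0) : m 0 ≡ m 1 [MOD 5] := by
  have h := coeff_aeval_scale ((1 + Complex.I * t) / s) ((1 - Complex.I * t) / s) V m
  rw [hV] at h
  generalize hζ : (1 + Complex.I * t) / s = ζ at h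
  generalize hξ : (1 - Complex.I * t) / s = ξ at h
  have hI := Complex.I_sq
  have h1 : ζ * ξ = 1 := by
    rw [← hζ, ← hξ]; field_simp; linear_combination ht - t ^ 2 * hI
  have h2 : ζ + ξ = 2 / s := by rw [← hζ, ← hξ]; ring
  have h3 : (2 / s) ^ 2 + 2 / s - 1 = 0 := by field_simp; linear_combination -hs
  rw [← h2] at h3
  have h4 : ζ ^ 4 + ζ ^ 3 + ζ ^ 2 + ζ + 1 = 0 := by
    linear_combination ζ ^ 2 * h3 - (ζ * ξ + 1 + 2 * ζ ^ 2 + ζ) * h1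
  have h5 : ζ ^ 5 = 1 := by linear_combination (ζ - 1) * h4
  have hne : ζ ≠ 1 := by
    rintro rfl
    norm_num at h4
  have ho : orderOf ζ = 5 := by
    have : Fact (Nat.Prime 5) := ⟨by norm_num⟩
    exact orderOf_eq_prime h5 hne
  have h6 : ζ ^ m 0 * ξ ^ m 1 = 1 := by
    refine mul_right_cancel₀ hm ?_
    rw [← h, one_mul]
  have h7 : ζ ^ m 0 = ζ ^ m 1 := by
    have : ζ ^ m 1 * ξ ^ m 1 = 1 := by rw [← mul_pow, h1, one_pow]
    linear_combination ζ ^ m 1 * h6 - ζ ^ m 0 * this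
  have hprim := IsPrimitiveRoot.orderOf ζ
  rw [← pow_mod_orderOf ζ (m 0), ← pow_mod_orderOf ζ (m 1)] at h7
  rw [ho] at hprim h7
  exact hprim.pow_inj (Nat.mod_lt _ (by norm_num)) (Nat.mod_lt _ (by norm_num)) h7

theorem diag_isHomogeneous (t : ℂ) {f : Poly} {n : ℕ} (hf : f.IsHomogeneous n) :
    (diag t f).IsHomogeneous n := by
  have := hf.aeval (m := n) (n := 1)
    (![C (1 / 2) * (X 0 + X 1), C (1 / (2 * Complex.I * t)) * (X 0 - X 1)] : Fin 2 → Poly)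
    (by
      intro i
      fin_cases i
      · exact ((isHomogeneous_X _ _).add (isHomogeneous_X _ _)).C_mul _
      · exact ((isHomogeneous_X _ _).sub (isHomogeneous_X _ _)).C_mul _)
  simpa [diag] using this

/-- The point `(1, X / t)` has coordinates `z = 1 + iX` and `w = 1 - iX`. -/
theorem aeval_diag {t : ℂ} (ht : t ≠ 0) (f : Poly) :
    aeval ![1 + PowerSeries.C Complex.I * PowerSeries.X,
      1 - PowerSeries.C Complex.I * PowerSeries.X] (diag t f) =
      aeval ![1, PowerSeries.C (1 / t) * PowerSeries.X] f := by
  suffices h : (aeval ![1 + PowerSeries.C Complex.I * PowerSeries.X,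
      1 - PowerSeries.C Complex.I * PowerSeries.X]).comp (diag t) =
      aeval ![1, PowerSeries.C (1 / t) * PowerSeries.X] from DFunLike.congr_fun h f
  have hC : ∀ c : ℂ, algebraMap ℂ (PowerSeries ℂ) c = PowerSeries.C c := fun _ => rfl
  refine MvPolynomial.algHom_ext fun i => ?_
  fin_cases i
  · have h2 : (PowerSeries.C (1 / 2 : ℂ)) * 2 = 1 := by
      rw [show (2 : PowerSeries ℂ) = PowerSeries.C 2 from rfl, ← map_mul]; norm_num
    simp only [diag, AlgHom.comp_apply, aeval_X]
    simp only [Fin.zero_eta, Matrix.cons_val_zero, Matrix.cons_val_one, map_mul,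
      map_add, algHom_C, hC, aeval_X]
    linear_combination h2
  · have h2 : PowerSeries.C (1 / (2 * Complex.I * t)) * 2 * PowerSeries.C Complex.I
        = PowerSeries.C (1 / t) := by
      rw [show (2 : PowerSeries ℂ) = PowerSeries.C 2 from rfl, ← map_mul, ← map_mul]
      congr 1; field_simp
    simp only [diag, AlgHom.comp_apply, aeval_X]
    simp only [Fin.mk_one, Matrix.cons_val_zero, Matrix.cons_val_one, map_mul,
      map_sub, algHom_C, hC, aeval_X]
    linear_combination PowerSeries.X * h2
end MallowsSloane

open MvPolynomial in
theorem theorem2 (n d : ℕ) (A : ℕ → ℂ) (W : MvPolynomial (Fin 2) ℂ)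
    (hW : W ∈ MallowsSloane.invariantRing)
    (hdn : d ≤ n) (hAd : A d ≠ 0)
    (hform : W = X 0 ^ n + ∑ i ∈ Finset.Icc d n, C (A i) * X 0 ^ (n - i) * X 1 ^ i)
    (hn : Even n) :
    (d : ℤ) ≤ 2 * ⌊(n : ℝ) / 10⌋ + 2 := by
  obtain ⟨N, hN⟩ := hn
  have hfl : ⌊(n : ℝ) / 10⌋ = ((n / 10 : ℕ) : ℤ) := by
    rw [← Nat.floor_div_eq_div (K := ℝ), Int.natCast_floor_eq_floor (by positivity)]
    norm_num
  rw [hfl]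
  by_contra hcon
  have hd : 2 * (n / 10 + 1) < d := by omega
  have hhom : W.IsHomogeneous n := by
    rw [hform]
    refine (isHomogeneous_X_pow 0 n).add (IsHomogeneous.sum _ _ _ fun i hi => ?_)
    have hi := Finset.mem_Icc.1 hi
    have := ((isHomogeneous_X_pow (R := ℂ) (0 : Fin 2) (n - i)).C_mul (A i)).mul
      (isHomogeneous_X_pow (1 : Fin 2) i)
    rwa [Nat.sub_add_cancel hi.2] at this
  obtain ⟨t, ht⟩ := IsAlgClosed.exists_pow_nat_eq ((MallowsSloane.q₀ : ℂ) - 1) two_pos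
  set s : ℂ := ((Real.sqrt MallowsSloane.q₀ : ℝ) : ℂ) with hs
  have hsq : s ^ 2 = (MallowsSloane.q₀ : ℂ) := by
    rw [hs]; exact_mod_cast Real.sq_sqrt MallowsSloane.q₀_pos.le
  have hs0 : s ≠ 0 := by
    rw [hs]; exact_mod_cast (Real.sqrt_pos.2 MallowsSloane.q₀_pos).ne'
  have hs2 : s ^ 2 = 2 * s + 4 := by
    rw [hsq, hs, MallowsSloane.sqrt_q₀, MallowsSloane.q₀]; push_cast; ring
  have ht0 : t ≠ 0 := by
    rintro rfl
    have h1 : (1 : ℝ) < MallowsSloane.q₀ := by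
      rw [MallowsSloane.q₀]; linarith [Real.sqrt_nonneg 5]
    have : (MallowsSloane.q₀ : ℂ) = 1 := by linear_combination -ht
    exact h1.ne' (by exact_mod_cast this)
  set V := MallowsSloane.diag t W with hV
  have hrot := MallowsSloane.diag_rotation hs0 ht0 W
  rw [MallowsSloane.invariant_rotation hW hs ht, ← hV] at hrot
  have hVhom := MallowsSloane.diag_isHomogeneous t hhom
  rw [← hV] at hVhom
  have hWt := MallowsSloane.aeval_diag ht0 W
  rw [← hV] at hWt
  refine sum_ne_one_add_X_pow_mul V.support (fun m => coeff m V) (fun m => m 0) (fun m => m 1)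
    (k := n / 10 + 1) (N := N) (d := d)
    (∑ i ∈ Finset.Icc d n, PowerSeries.C (A i * (1 / t) ^ i) * PowerSeries.X ^ (i - d))
    (by omega) (by omega) hd ?_ ?_
  · intro m hm
    have hmod := MallowsSloane.modEq_five_of_coeff_ne_zero hs2 hs0 (by rw [ht, hsq]) hrot
      (mem_support_iff.1 hm)
    have hdeg : m 0 + m 1 = n := by
      have := hVhom (mem_support_iff.1 hm)
      simpa [Finsupp.weight_apply, Finsupp.sum_fintype, Fin.sum_univ_two] using this
    -- `2 (m 0 - N) = m 0 - m 1` is divisible by `5`, hence so is `m 0 - N`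
    have hmod' : m 0 % 5 = m 1 % 5 := hmod
    refine ⟨by omega, (m 0 + 5 * (n / 10 + 1) - N) / 5, ?_⟩
    omega
  · have hC : ∀ c : ℂ, algebraMap ℂ (PowerSeries ℂ) c = PowerSeries.C c := fun _ => rfl
    have h1 : aeval ![1 + PowerSeries.C Complex.I * PowerSeries.X,
        1 - PowerSeries.C Complex.I * PowerSeries.X] V = ∑ m ∈ V.support,
        PowerSeries.C (coeff m V) * ((1 + PowerSeries.C Complex.I * PowerSeries.X) ^ m 0 *
          (1 - PowerSeries.C Complex.I * PowerSeries.X) ^ m 1) := by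
      rw [aeval_def, eval₂_eq']
      refine Finset.sum_congr rfl fun m _ => ?_
      rw [Fin.prod_univ_two, hC]
      rfl
    rw [← h1, hWt, hform, Finset.mul_sum]
    simp only [map_add, map_sum, map_mul, map_pow, aeval_X, algHom_C, hC, Matrix.cons_val_zero,
      Matrix.cons_val_one, one_pow, mul_one]
    congr 1
    refine Finset.sum_congr rfl fun i hi => ?_
    obtain ⟨j, rfl⟩ := Nat.exists_eq_add_of_le (Finset.mem_Icc.1 hi).1
    rw [Nat.add_sub_cancel_left]
    ring
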